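/- Let $P$ be an $n$-gon, $n\ge 3$, with vertices $0,1,\dots,n-1$ in cyclic order. A dissection of $P$ is a set of pairwise non-crossing diagonals of $P$; it is a $p$-angulation if it divides $P$ into $p$-gons only, and a $3$-angulation is called a triangulation. A frieze on $P$ with values in an integral domain $R$ is a map $f$ from pairs of vertices to $R$ such that $f(i,j)=0$ if and only if $i=j$; $f(i,i+1)=f(i,i-1)=1$ (indices modulo $n$); $f(i,j)=f(j,i)$; and $f(i,j)f(k,\ell)=f(i,\ell)f(j,k)+f(i,k)f(j,\ell)$ whenever $(i,j)$ and $(k,\ell)$ cross. The frieze is unitary if there is a triangulation $T$ of $P$ such that $f(\tau)\in R^\times$ for every $\tau\in T$. The frieze from a dissection $\mathcal D$ is the frieze $f_{\mathcal D}$ on $P$ which, on each $p$-gon of $\mathcal D$ with vertices numbered $0,\dots,p-1$ in cyclic order, restricts to the Euclidean frieze $\mathcal L_p(a,b)=U_{|b-a|-1}(2\cos(\pi/p))$, where $U_{-1}=0$, $U_0=1$, $U_1(x)=x$ and $U_k(x)=x\,U_{k-1}(x)-U_{k-2}(x)$. Let $\mathcal D$ be a $4$-angulation of $P$, and let $f_{\mathcal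 D}$ be the frieze from $\mathcal D$, with values in $\mathbb Z[\sqrt 2]$. Then $f_{\mathcal D}$ is not unitary: there is no triangulation of $P$ all of whose arcs have weight in $\mathbb Z[\sqrt 2]^\times$. -/

import Mathlib

/-!
Vertices of an `n`-gon are the elements of `Fin n`, with the cyclic order `sbtw` of Mathlib and
with cyclic addition (`i + 1` is the successor of `i` modulo `n`). Arcs are unordered pairs
`s(i, j)` of vertices.
-/

namespace PolygonFrieze

/-- The arc between `i` and `j` is a boundary arc, i.e. the two vertices are cyclically adjacent. -/
def IsBoundary {n : ℕ} [NeZero n] (i j : Fin n) : Prop := j = i + 1 ∨ i = j + 1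

/-- The arcs `(i, j)` and `(k, l)` cross: `i < k < j < l` or `i < l < j < k` cyclically. -/
def Cross {n : ℕ} (i j k l : Fin n) : Prop :=
  (sbtw i k j ∧ sbtw j l i) ∨ (sbtw i l j ∧ sbtw j k i)

/-- A dissection: a set of pairwise non-crossing diagonals (non-boundary arcs) of the `n`-gon. -/
structure IsDissection {n : ℕ} [NeZero n] (D : Set (Sym2 (Fin n))) : Prop where
  ne : ∀ i j, s(i, j) ∈ D → i ≠ j
  not_boundary : ∀ i j, s(i, j) ∈ D → ¬ IsBoundary i j
  not_cross : ∀ i j k l, s(i, j) ∈ D → s(k, l) ∈ D → ¬ Cross i j k l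

/-- `j` is the vertex that follows `i` in the cyclic order of the vertex set `W`. -/
def IsNext {n : ℕ} (W : Finset (Fin n)) (i j : Fin n) : Prop :=
  i ∈ W ∧ j ∈ W ∧ i ≠ j ∧ ∀ w ∈ W, ¬ sbtw i w j

/-- `W` is the vertex set of one of the subpolygons into which `D` divides the `n`-gon: it has at
least three vertices, each of its sides is a boundary arc of the `n`-gon or an arc of `D`, and no
arc of `D` is a diagonal of it. -/
structure IsSubpolygon {n : ℕ} [NeZero n] (D : Set (Sym2 (Fin n))) (W : Finset (Fin n)) :
    Prop where
  three_le : 3 ≤ W.card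
  side : ∀ i j, IsNext W i j → s(i, j) ∈ D ∨ IsBoundary i j
  no_diagonal : ∀ i ∈ W, ∀ j ∈ W, s(i, j) ∈ D → IsNext W i j ∨ IsNext W j i

/-- A `p`-angulation: a dissection that divides the `n`-gon into `p`-gons. -/
structure IsAngulation {n : ℕ} [NeZero n] (p : ℕ) (D : Set (Sym2 (Fin n))) : Prop where
  dissection : IsDissection D
  card_eq : ∀ W, IsSubpolygon D W → W.card = p

/-- A frieze on the `n`-gon with values in an integral domain `R`. -/
structure IsFrieze {n : ℕ} [NeZero n] {R : Type*} [CommRing R] [IsDomain R]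
    (f : Fin n → Fin n → R) : Prop where
  eq_zero_iff : ∀ i j, f i j = 0 ↔ i = j
  succ : ∀ i, f i (i + 1) = 1
  pred : ∀ i, f i (i - 1) = 1
  symm : ∀ i j, f i j = f j i
  ptolemy : ∀ i j k l, Cross i j k l → f i j * f k l = f i l * f j k + f i k * f j l

/-- A frieze is unitary if all arcs of some triangulation of the `n`-gon have unit weight. -/
def IsUnitary {n : ℕ} [NeZero n] {R : Type*} [CommRing R] (f : Fin n → Fin n → R) : Prop :=
  ∃ T : Set (Sym2 (Fin n)), IsAngulation 3 T ∧ ∀ i j, s(i, j) ∈ T → IsUnit (f i j)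

/-- `λ_p = 2 cos (π / p)`. -/
noncomputable def lam (p : ℕ) : ℝ := 2 * Real.cos (Real.pi / p)

/-- The Euclidean frieze `𝓛_p(i, j) = U_{|j - i| - 1}(λ_p)` on the `p`-gon. The normalized
Chebyshev polynomials of the second kind (`U_{-1} = 0`, `U_0 = 1`, `U_k = x U_{k-1} - U_{k-2}`)
are `Polynomial.Chebyshev.S` in Mathlib. -/
noncomputable def euclideanFrieze (p : ℕ) (i j : Fin p) : ℝ :=
  (Polynomial.Chebyshev.S ℝ (|(j : ℤ) - (i : ℤ)| - 1)).eval (lam p)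

/-- `f`, with values in a ring `R` of real numbers, is the frieze from the dissection `D`: it is a
frieze, and on each `p`-gon of `D`, whose vertices are numbered `0, …, p - 1` in increasing order,
it restricts to the Euclidean frieze. -/
structure IsFriezeFromDissection {n : ℕ} [NeZero n] {R : Subring ℝ}
    (D : Set (Sym2 (Fin n))) (f : Fin n → Fin n → R) : Prop where
  frieze : IsFrieze f
  restrict : ∀ (p : ℕ) (W : Finset (Fin n)) (hW : W.card = p), IsSubpolygon D W →
    ∀ a b : Fin p, (f (W.orderEmbOfFin hW a) (W.orderEmbOfFin hW b) : ℝ) = euclideanFrieze p a b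

/-- The ring `ℤ[√2]` of real numbers. -/
noncomputable def zSqrtTwo : Subring ℝ := Subring.closure {√2}

end PolygonFrieze

namespace PolygonFrieze

/-! ### Polygons with sides in a dissection -/

/-! For `n ≥ 4` every triangulation has an ear, that is, contains an arc `(i, i + 2)`. In a frieze
from a 4-angulation, the weight of such an arc is the sum of `√2` over the quadrilaterals at `i +
1`, hence a multiple of `√2`, which is not a unit of `ℤ[√2]`. Ears come from
`IsAngulation.exists_ear`. Divisibility is `IsPolygon.rootTwo_dvd`, by induction on unions of
quadrilaterals: cut along an arc of `D` and glue by the Ptolemy relation. -/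

lemma sbtw_iff_val {n : ℕ} (a b c : Fin n) : sbtw a b c ↔
    (a.val < b.val ∧ b.val < c.val) ∨ (b.val < c.val ∧ c.val < a.val) ∨
      (c.val < a.val ∧ a.val < b.val) := Iff.rfl

/-- `W` is the vertex set of a union of subpolygons of `D`: each of its sides is a boundary arc or
an arc of `D`. -/
structure IsPolygon {n : ℕ} [NeZero n] (D : Set (Sym2 (Fin n))) (W : Finset (Fin n)) :
    Prop where
  three_le : 3 ≤ W.card
  side : ∀ i j, IsNext W i j → s(i, j) ∈ D ∨ IsBoundary i j

/-- The part of `W` on the side of the arc `(a, b)` that is traversed from `a` to `b`. -/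
noncomputable def cut {n : ℕ} (W : Finset (Fin n)) (a b : Fin n) : Finset (Fin n) :=
  open Classical in W.filter fun w => ¬ sbtw b w a

lemma mem_cut {n : ℕ} {W : Finset (Fin n)} {a b w : Fin n} :
    w ∈ cut W a b ↔ w ∈ W ∧ ¬ sbtw b w a := by
  simp [cut]

/-- A vertex of `W` strictly between `i` and `j` must have been cut off, so it lies strictly between
`b` and `a`. The stretch from `i` to `j` then contains the one from `b` to `a`, and the two coincide
because `a` and `b` survive the cut. -/
lemma isNext_of_isNext_cut {n : ℕ} {W : Finset (Fin n)} {a b i j : Fin n} (ha : a ∈ W)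
    (hb : b ∈ W) (hab : a ≠ b) (h : IsNext (cut W a b) i j) :
    IsNext W i j ∨ (i = b ∧ j = a) := by
  obtain ⟨hi, hj, hij, h⟩ := h
  rw [mem_cut] at hi hj
  by_contra! hc
  obtain ⟨hc, hc'⟩ := hc
  apply hc
  refine ⟨hi.1, hj.1, hij, fun w hw hs => ?_⟩
  have h1 := h w
  have h2 := h a
  have h3 := h b
  rw [mem_cut] at h1 h2 h3
  simp only [hw, ha, hb, true_and] at h1 h2 h3
  have hi2 := hi.2
  have hj2 := hj.2
  simp only [sbtw_iff_val] at h1 h2 h3 hi2 hj2 hs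
  simp only [Fin.ext_iff, ne_eq] at *
  clear h hc hi hj
  omega

lemma isNext_cut {n : ℕ} {W : Finset (Fin n)} {a b i j : Fin n} (h : IsNext W i j)
    (hi : ¬ sbtw b i a) (hj : ¬ sbtw b j a) : IsNext (cut W a b) i j :=
  ⟨mem_cut.2 ⟨h.1, hi⟩, mem_cut.2 ⟨h.2.1, hj⟩, h.2.2.1, fun w hw => h.2.2.2 w (mem_cut.1 hw).1⟩

lemma isNext_cut_self {n : ℕ} {W : Finset (Fin n)} {a b : Fin n} (ha : a ∈ W) (hb : b ∈ W)
    (hab : a ≠ b) : IsNext (cut W a b) b a := by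
  refine ⟨mem_cut.2 ⟨hb, ?_⟩, mem_cut.2 ⟨ha, ?_⟩, hab.symm, fun w hw => (mem_cut.1 hw).2⟩ <;>
    · simp only [sbtw_iff_val]
      omega

lemma exists_sbtw_of_not_isNext {n : ℕ} {W : Finset (Fin n)} {a b : Fin n} (ha : a ∈ W)
    (hb : b ∈ W) (hab : a ≠ b) (h : ¬ IsNext W a b) : ∃ w ∈ W, sbtw a w b := by
  by_contra! hc
  exact h ⟨ha, hb, hab, hc⟩

lemma card_cut_lt {n : ℕ} {W : Finset (Fin n)} {a b : Fin n} (ha : a ∈ W)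
    (hb : b ∈ W) (hab : a ≠ b) (h : ¬ IsNext W b a) : (cut W a b).card < W.card := by
  obtain ⟨w, hw, hs⟩ := exists_sbtw_of_not_isNext hb ha hab.symm h
  refine Finset.card_lt_card (Finset.ssubset_iff_subset_ne.2
    ⟨fun w hw => (mem_cut.1 hw).1, fun he => ?_⟩)
  rw [← he] at hw
  exact (mem_cut.1 hw).2 hs

lemma IsPolygon.cut {n : ℕ} [NeZero n] {D : Set (Sym2 (Fin n))} {W : Finset (Fin n)}
    {a b : Fin n} (hW : IsPolygon D W) (ha : a ∈ W) (hb : b ∈ W) (hab : a ≠ b)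
    (hD : s(a, b) ∈ D) (h : ¬ IsNext W a b) : IsPolygon D (cut W a b) where
  three_le := by
    obtain ⟨w, hw, hs⟩ := exists_sbtw_of_not_isNext ha hb hab h
    rw [sbtw_iff_val] at hs
    have hsub : {a, b, w} ⊆ PolygonFrieze.cut W a b := by
      intro x hx
      simp only [Finset.mem_insert, Finset.mem_singleton] at hx
      rw [mem_cut, sbtw_iff_val]
      rcases hx with rfl | rfl | rfl <;> refine ⟨by assumption, ?_⟩ <;> omega
    refine le_trans (le_of_eq ?_) (Finset.card_le_card hsub)
    rw [Finset.card_eq_three.2 ⟨a, b, w, hab, ?_, ?_, rfl⟩] <;>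
      · rw [ne_eq, Fin.ext_iff]; omega
  side i j hij := by
    rcases isNext_of_isNext_cut ha hb hab hij with h | ⟨rfl, rfl⟩
    · exact hW.side i j h
    · exact Or.inl (Sym2.eq_swap ▸ hD)

/-- Two consecutive vertices of `W` are not separated by an arc between vertices of `W`. -/
lemma IsNext.not_sbtw_or {n : ℕ} {W : Finset (Fin n)} {a b i j : Fin n} (ha : a ∈ W)
    (hb : b ∈ W) (h : IsNext W i j) :
    (¬ sbtw b i a ∧ ¬ sbtw b j a) ∨ (¬ sbtw a i b ∧ ¬ sbtw a j b) := by
  have h1 := h.2.2.2 a ha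
  have h2 := h.2.2.2 b hb
  have h3 := h.2.2.1
  simp only [sbtw_iff_val, Fin.ext_iff, ne_eq] at *
  omega

lemma cross_of_isNext {n : ℕ} {W : Finset (Fin n)} {i j k b : Fin n} (h1 : IsNext W i j)
    (h2 : IsNext W j k) (hb : b ∈ W) (hi : b ≠ i) (hj : b ≠ j) (hk : b ≠ k) (hik : i ≠ k) :
    Cross i k j b := by
  have e1 := h1.2.2.2 b hb
  have e2 := h2.2.2.2 b hb
  have e3 := h1.2.2.2 k h2.2.1
  have e4 := h1.2.2.1
  have e5 := h2.2.2.1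
  simp only [Cross, sbtw_iff_val, Fin.ext_iff, ne_eq] at *
  omega

lemma isNext_univ {n : ℕ} [NeZero n] {i j : Fin n} (h : IsNext Finset.univ i j) : j = i + 1 := by
  obtain ⟨-, -, hij, h⟩ := h
  by_contra hc
  have h1 := h (i + 1) (Finset.mem_univ _)
  simp only [sbtw_iff_val, Fin.ext_iff, ne_eq] at *
  have hi := i.isLt
  have hj := j.isLt
  have hn : 2 ≤ n := by omega
  have hv : (i + 1).val = if i.val + 1 = n then 0 else i.val + 1 := by
    rw [Fin.val_add, Fin.val_one', Nat.mod_eq_of_lt hn]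
    split_ifs with he
    · simp [he]
    · exact Nat.mod_eq_of_lt (by omega)
  rw [hv] at hc h1
  split_ifs at hc h1 <;> omega

lemma isNext_univ_of_val {n : ℕ} {i j : Fin n} (h : j.val = i.val + 1) :
    IsNext Finset.univ i j := by
  refine ⟨Finset.mem_univ _, Finset.mem_univ _, ?_, fun w _ => ?_⟩
  · rw [ne_eq, Fin.ext_iff]; omega
  · rw [sbtw_iff_val]; omega

lemma isPolygon_univ {n : ℕ} [NeZero n] (hn : 3 ≤ n) (D : Set (Sym2 (Fin n))) :
    IsPolygon D Finset.univ where
  three_le := by simpa using hn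
  side _ _ h := Or.inr (Or.inl (isNext_univ h))

/-! ### Ears of triangulations -/

lemma isNext_Icc {n : ℕ} {c d i j : Fin n} (h : IsNext (Finset.Icc c d) i j) :
    j.val = i.val + 1 ∨ (i = d ∧ j = c) := by
  obtain ⟨hi, hj, hij, h⟩ := h
  by_contra! hc
  simp only [Finset.mem_Icc, Fin.le_def] at hi hj
  rcases lt_or_ge i j with hlt | hge
  · rw [Fin.lt_def] at hlt
    have h1 := h ⟨i.val + 1, by omega⟩
    simp only [Finset.mem_Icc, Fin.le_def, sbtw_iff_val] at h1
    omega
  · have h1 := h c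
    have h2 := h d
    simp only [Finset.mem_Icc, Fin.le_def, sbtw_iff_val, Fin.ext_iff] at *
    omega

/-- A triangulation of an `n`-gon with `n ≥ 4` has an ear. -/
lemma IsAngulation.exists_ear {n : ℕ} [NeZero n] (hn : 4 ≤ n) {T : Set (Sym2 (Fin n))}
    (hT : IsAngulation 3 T) :
    ∃ i j k : Fin n, IsNext Finset.univ i j ∧ IsNext Finset.univ j k ∧ i ≠ k ∧ s(i, k) ∈ T := by
  classical
  -- Without arcs the whole polygon would be a subpolygon with more than three vertices. So there is
  -- a shortest arc, with length measured in `ℕ`, not cyclically.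
  have hne : ∃ m, ∃ c d : Fin n, s(c, d) ∈ T ∧ d.val = c.val + m := by
    by_contra! hc
    have hno : ∀ i j : Fin n, s(i, j) ∉ T := by
      intro i j hij
      rcases le_total i j with h | h <;> rw [Fin.le_def] at h
      · exact hc (j.val - i.val) i j hij (by omega)
      · exact hc (i.val - j.val) j i (Sym2.eq_swap ▸ hij) (by omega)
    have hu := hT.card_eq Finset.univ ⟨by simp; omega, (isPolygon_univ (by omega) T).side,
      fun i _ j _ h => (hno i j h).elim⟩
    simp at hu
    omega
  obtain ⟨c, d, hcd, hm⟩ := Nat.find_spec hne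
  set m := Nat.find hne with hmdef
  have hmin : ∀ i j : Fin n, s(i, j) ∈ T → i.val ≤ j.val → m ≤ j.val - i.val := fun i j hij hle =>
    Nat.find_min' hne ⟨i, j, hij, by omega⟩
  have hcdne := hT.dissection.ne c d hcd
  have hbd := hT.dissection.not_boundary c d hcd
  have hd := d.isLt
  have hm2 : 2 ≤ m := by
    by_contra! hlt
    rcases Nat.eq_zero_or_pos m with h0 | h0
    · exact hcdne (Fin.ext (by omega))
    · exact hbd (Or.inl (isNext_univ (isNext_univ_of_val (by omega))))
  have hnext : IsNext (Finset.Icc c d) d c := by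
    refine ⟨?_, ?_, hcdne.symm, fun w hw => ?_⟩ <;>
      simp only [Finset.mem_Icc, Fin.le_def, sbtw_iff_val] at * <;> omega
  have hcard : (Finset.Icc c d).card = m + 1 := by
    rw [Fin.card_Icc]; omega
  -- By minimality no other arc of `T` lies within `[c, d]`. This interval is therefore a triangle,
  -- and `d = c + 2`.
  have hsub : IsSubpolygon T (Finset.Icc c d) := by
    have key : ∀ i ∈ Finset.Icc c d, ∀ j ∈ Finset.Icc c d, s(i, j) ∈ T → i.val ≤ j.val →
        IsNext (Finset.Icc c d) j i := by
      intro i hi j hj hij hle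
      have := hmin i j hij hle
      simp only [Finset.mem_Icc, Fin.le_def] at hi hj
      obtain rfl : i = c := Fin.ext (by omega)
      obtain rfl : j = d := Fin.ext (by omega)
      exact hnext
    refine ⟨by omega, fun i j hij => ?_, fun i hi j hj hij => ?_⟩
    · rcases isNext_Icc hij with h | ⟨rfl, rfl⟩
      · exact Or.inr (Or.inl (isNext_univ (isNext_univ_of_val h)))
      · exact Or.inl (Sym2.eq_swap ▸ hcd)
    · rcases le_total i.val j.val with h | h
      · exact Or.inr (key i hi j hj hij h)
      · exact Or.inl (key j hj i hi (Sym2.eq_swap ▸ hij) h)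
  have h3 := hT.card_eq _ hsub
  exact ⟨c, ⟨c.val + 1, by omega⟩, d, isNext_univ_of_val rfl,
    isNext_univ_of_val (by simp; omega), hcdne, hcd⟩

/-! ### The Euclidean frieze on a quadrilateral -/

lemma lam_four : lam 4 = √2 := by
  have := Real.cos_pi_div_four
  simp only [lam, Nat.cast_ofNat, this]
  ring

lemma euclideanFrieze_four_succ (a : Fin 4) : euclideanFrieze 4 a (a + 1) = 1 := by
  -- Needed for the side that wraps around from 3 to 0, where the index is `|0 - 3| - 1 = 2`.
  have h : (Polynomial.Chebyshev.S ℝ 2).eval (lam 4) = 1 := by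
    rw [Polynomial.Chebyshev.S_two, lam_four]
    norm_num
  fin_cases a <;> simp [euclideanFrieze]
  norm_num [h]

lemma euclideanFrieze_four_add_two (a : Fin 4) : euclideanFrieze 4 a (a + 1 + 1) = √2 := by
  have h : (2 : ℤ) - 1 = 1 := rfl
  fin_cases a <;> simp [euclideanFrieze, h, lam_four]

lemma isNext_orderEmbOfFin_four {n : ℕ} {W : Finset (Fin n)} (hW : W.card = 4) {a b : Fin 4}
    (h : IsNext W (W.orderEmbOfFin hW a) (W.orderEmbOfFin hW b)) : b = a + 1 := by
  obtain ⟨-, -, hne, h⟩ := h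
  have h1 : ∀ c : Fin 4, ¬ ((a < c ∧ c < b) ∨ (c < b ∧ b < a) ∨ (b < a ∧ a < c)) := fun c => by
    have := h (W.orderEmbOfFin hW c) (Finset.orderEmbOfFin_mem W hW c)
    simpa only [Fin.sbtw_iff, OrderEmbedding.lt_iff_lt] using this
  have h2 : a ≠ b := fun e => hne (by rw [e])
  clear h hne
  revert h1 h2
  revert a b
  decide

lemma isSubpolygon_frieze_four {n : ℕ} [NeZero n] {R : Subring ℝ} {D : Set (Sym2 (Fin n))}
    {f : Fin n → Fin n → R} (hf : IsFriezeFromDissection D f) {W : Finset (Fin n)}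
    (hW : IsSubpolygon D W) (h4 : W.card = 4) :
    (∀ i j, IsNext W i j → (f i j : ℝ) = 1) ∧
      ∀ i j k, IsNext W i j → IsNext W j k → (f i k : ℝ) = √2 := by
  have hex : ∀ w ∈ W, ∃ a, W.orderEmbOfFin h4 a = w := fun w hw => by
    have : w ∈ Set.range (W.orderEmbOfFin h4) := by
      rw [Finset.range_orderEmbOfFin]; exact hw
    exact this
  have hr := hf.restrict 4 W h4 hW
  refine ⟨fun i j hij => ?_, fun i j k hij hjk => ?_⟩
  · obtain ⟨a, rfl⟩ := hex i hij.1
    obtain ⟨b, rfl⟩ := hex j hij.2.1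
    rw [hr, isNext_orderEmbOfFin_four h4 hij, euclideanFrieze_four_succ]
  · obtain ⟨a, rfl⟩ := hex i hij.1
    obtain ⟨b, rfl⟩ := hex j hij.2.1
    obtain ⟨c, rfl⟩ := hex k hjk.2.1
    rw [hr, isNext_orderEmbOfFin_four h4 hjk, isNext_orderEmbOfFin_four h4 hij,
      euclideanFrieze_four_add_two]

/-! ### Divisibility by `√2` -/

/-- The element `√2` of `ℤ[√2]`. -/
noncomputable def rootTwo : zSqrtTwo := ⟨√2, Subring.subset_closure rfl⟩

lemma exists_int_of_mem_zSqrtTwo {x : ℝ} (hx : x ∈ zSqrtTwo) : ∃ a b : ℤ, x = a + b * √2 := by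
  have h2 : √2 * √2 = 2 := Real.mul_self_sqrt (by norm_num)
  induction hx using Subring.closure_induction with
  | mem x hx => exact ⟨0, 1, by rw [Set.mem_singleton_iff.1 hx]; simp⟩
  | zero => exact ⟨0, 0, by simp⟩
  | one => exact ⟨1, 0, by simp⟩
  | add x y _ _ hx hy =>
    obtain ⟨a, b, rfl⟩ := hx
    obtain ⟨c, d, rfl⟩ := hy
    exact ⟨a + c, b + d, by push_cast; ring⟩
  | neg x _ hx =>
    obtain ⟨a, b, rfl⟩ := hx
    exact ⟨-a, -b, by push_cast; ring⟩
  | mul x y _ _ hx hy =>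
    obtain ⟨a, b, rfl⟩ := hx
    obtain ⟨c, d, rfl⟩ := hy
    exact ⟨a * c + 2 * (b * d), a * d + b * c, by push_cast; linear_combination b * d * h2⟩

/-- An inverse `a + b√2` would give `a√2 = 1 - 2b`, which contradicts irrationality if `a ≠ 0` and
parity if `a = 0`. -/
lemma not_isUnit_rootTwo : ¬ IsUnit rootTwo := by
  intro h
  obtain ⟨y, hy⟩ := h.exists_right_inv
  obtain ⟨a, b, hab⟩ := exists_int_of_mem_zSqrtTwo y.2
  have h1 : √2 * (a + b * √2) = 1 := by
    rw [← hab]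
    exact congrArg Subtype.val hy
  have h2 : √2 * √2 = 2 := Real.mul_self_sqrt (by norm_num)
  have h3 : (a : ℝ) * √2 = ((1 - 2 * b : ℤ) : ℝ) := by
    push_cast
    linear_combination h1 - b * h2
  rcases eq_or_ne a 0 with rfl | ha
  · rw [Int.cast_zero, zero_mul] at h3
    have : (0 : ℤ) = 1 - 2 * b := by exact_mod_cast h3
    omega
  · exact (irrational_sqrt_two.intCast_mul ha).ne_int _ h3

/-- In the frieze from a 4-angulation, every arc that cuts off a single vertex of a union of
quadrilaterals has weight divisible by `√2`. -/
lemma IsPolygon.rootTwo_dvd {n : ℕ} [NeZero n] {D : Set (Sym2 (Fin n))}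
    (hD : IsAngulation 4 D) {f : Fin n → Fin n → zSqrtTwo} (hf : IsFriezeFromDissection D f)
    {W : Finset (Fin n)} (hW : IsPolygon D W) :
    (∀ i j, IsNext W i j → f i j = 1) ∧
      ∀ i j k, IsNext W i j → IsNext W j k → i ≠ k → rootTwo ∣ f i k := by
  induction hm : W.card using Nat.strong_induction_on generalizing W with
  | _ m ih =>
  subst hm
  -- Base case: no arc of `D` is a diagonal of `W`, so `W` is a single quadrilateral.
  by_cases hd : ∀ i ∈ W, ∀ j ∈ W, s(i, j) ∈ D → IsNext W i j ∨ IsNext W j i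
  · have hsub : IsSubpolygon D W := ⟨hW.three_le, hW.side, hd⟩
    obtain ⟨h1, h2⟩ := isSubpolygon_frieze_four hf hsub (hD.card_eq W hsub)
    exact ⟨fun i j hij => Subtype.ext (h1 i j hij), fun i j k hij hjk _ =>
      dvd_of_eq (Subtype.ext (h2 i j k hij hjk).symm)⟩
  push Not at hd
  obtain ⟨a, ha, b, hb, hab, hn1, hn2⟩ := hd
  have hne := hD.dissection.ne a b hab
  have hba : s(b, a) ∈ D := Sym2.eq_swap ▸ hab
  obtain ⟨s1, t1⟩ := ih _ (card_cut_lt ha hb hne hn2) (hW.cut ha hb hne hab hn1) rfl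
  obtain ⟨s2, t2⟩ := ih _ (card_cut_lt hb ha hne.symm hn1) (hW.cut hb ha hne.symm hba hn2) rfl
  refine ⟨fun i j hij => ?_, fun i j k hij hjk hik => ?_⟩
  · rcases hij.not_sbtw_or ha hb with ⟨h, h'⟩ | ⟨h, h'⟩
    · exact s1 i j (isNext_cut hij h h')
    · exact s2 i j (isNext_cut hij h h')
  have hub : f b a = 1 := s1 b a (isNext_cut_self ha hb hne)
  have hua : f a b = 1 := s2 a b (isNext_cut_self hb ha hne.symm)
  -- the two parts meet in an arc at the middle vertex
  have glue : ∀ a b : Fin n, a ∈ W → b ∈ W → a ≠ b → ¬ IsNext W a b → ¬ IsNext W b a →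
      f a b = 1 →
      (∀ i j k, IsNext (PolygonFrieze.cut W a b) i j → IsNext (PolygonFrieze.cut W a b) j k →
        i ≠ k → rootTwo ∣ f i k) →
      (∀ i j k, IsNext (PolygonFrieze.cut W b a) i j → IsNext (PolygonFrieze.cut W b a) j k →
        i ≠ k → rootTwo ∣ f i k) →
      j = a → rootTwo ∣ f i k := by
    rintro a b ha hb hne hn1 hn2 hone t1 t2 rfl
    have hbi : b ≠ i := by rintro rfl; exact hn2 hij
    have hbk : b ≠ k := by rintro rfl; exact hn1 hjk
    have n1 : IsNext (PolygonFrieze.cut W j b) j k := by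
      refine isNext_cut hjk ?_ fun h => hjk.2.2.2 b hb h.cyclic_right
      simp only [sbtw_iff_val]; omega
    have n2 : IsNext (PolygonFrieze.cut W b j) i j := by
      refine isNext_cut hij (fun h => hij.2.2.2 b hb h.cyclic_left) ?_
      simp only [sbtw_iff_val]; omega
    have d1 := t1 b j k (isNext_cut_self ha hb hne) n1 hbk
    have d2 := t2 i j b n2 (isNext_cut_self hb ha hne.symm) hbi.symm
    have hp := hf.frieze.ptolemy i k j b
      -- Since `f j b = f i j = f j k = 1` up to symmetry, the relation amounts to `f i k = f i b +
      -- f b k`. Each summand skips only `j` in its own part; divisibility of both is all that is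
      -- used.
      (cross_of_isNext hij hjk hb hbi hne.symm hbk hik)
    rw [hone, mul_one, hf.frieze.symm k b] at hp
    rw [hp]
    exact dvd_add (d2.mul_right _) (d1.mul_left _)
  by_cases hja : j = a
  · exact glue a b ha hb hne hn1 hn2 hua t1 t2 hja
  by_cases hjb : j = b
  · exact glue b a hb ha hne.symm hn2 hn1 hub t2 t1 hjb
  -- Here `j` is not an endpoint of the cut, so it and both its neighbours lie in the same part.
  by_cases hs : sbtw b j a
  · have hij' := hij.not_sbtw_or ha hb
    have hjk' := hjk.not_sbtw_or ha hb
    have h1 : ¬ sbtw a i b ∧ ¬ sbtw a j b := hij'.resolve_left fun h => h.2 hs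
    have h2 : ¬ sbtw a j b ∧ ¬ sbtw a k b := hjk'.resolve_left fun h => h.1 hs
    exact t2 i j k (isNext_cut hij h1.1 h1.2) (isNext_cut hjk h2.1 h2.2) hik
  · have hs' : sbtw a j b := by
      simp only [sbtw_iff_val, Fin.ext_iff] at hs hja hjb ⊢
      rw [ne_eq, Fin.ext_iff] at hne
      omega
    have h1 := (hij.not_sbtw_or ha hb).resolve_right fun h => h.2 hs'
    have h2 := (hjk.not_sbtw_or ha hb).resolve_right fun h => h.1 hs'
    exact t1 i j k (isNext_cut hij h1.1 h1.2) (isNext_cut hjk h2.1 h2.2) hik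

/-- The triangle has no 4-angulation. -/
lemma not_isAngulation_four_of_three {D : Set (Sym2 (Fin 3))} : ¬ IsAngulation 4 D := by
  intro hD
  have hno : ∀ i j : Fin 3, s(i, j) ∉ D := fun i j hij => by
    have h : ∀ i j : Fin 3, i ≠ j → j = i + 1 ∨ i = j + 1 := by decide
    exact hD.dissection.not_boundary i j hij (h i j (hD.dissection.ne i j hij))
  have := hD.card_eq Finset.univ ⟨by simp, (isPolygon_univ le_rfl D).side,
    fun i _ j _ h => (hno i j h).elim⟩
  simp at this

end PolygonFrieze

theorem mainTheorem5 (n : ℕ) [NeZero n] (hn : 3 ≤ n) (D : Set (Sym2 (Fin n)))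
    (hD : PolygonFrieze.IsAngulation 4 D)
    (f : Fin n → Fin n → PolygonFrieze.zSqrtTwo)
    (hf : PolygonFrieze.IsFriezeFromDissection D f) :
    ¬ PolygonFrieze.IsUnitary f := by
  rintro ⟨T, hT, hu⟩
  rcases hn.eq_or_lt with rfl | hn4
  · exact PolygonFrieze.not_isAngulation_four_of_three hD
  obtain ⟨i, j, k, hij, hjk, hik, hmem⟩ := hT.exists_ear hn4
  have hdvd := ((PolygonFrieze.isPolygon_univ hn D).rootTwo_dvd hD hf).2 i j k hij hjk hik
  exact PolygonFrieze.not_isUnit_rootTwo (isUnit_of_dvd_unit hdvd (hu i k hmem))
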